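/- Fix $m,n$ and symmetric positive definite matrices $L_0\in\mathbb R^{m\times m}$, $R_0\in\mathbb R^{n\times n}$ (for instance $L_0=I_m$, $R_0=I_n$). KrADagrad with exponent $1/2$, update set $\mathcal I\subseteq\mathbb N$ and step size $\eta>0$ starts from arbitrary $W_1\in\mathbb R^{m\times n}$ and in iteration $k=1,\dots,K$ observes $G_k=\nabla f_k(W_k)$ and sets $$L_k=L_{k-1}-\tfrac1{t_k}L_{k-1}G_kR_{k-1}G_k^\top L_{k-1},\quad R_k=R_{k-1}\qquad\text{if }k\in\mathcal I,$$ $$R_k=R_{k-1}-\tfrac1{t_k}R_{k-1}G_k^\top L_{k-1}G_kR_{k-1},\quad L_k=L_{k-1}\qquad\text{if }k\notin\mathcal I,$$ $$W_{k+1}=W_k-\eta\,L_k^{1/2}G_kR_k^{1/2},$$ where $t_k=1+\|L_{k-1}G_kR_{k-1}G_k^\top\|$ with the spectral or the Frobenius norm (if $k\notin\mathcal I$, also $t_k=1+\|R_{k-1}G_k^\top L_{k-1}G_k\|$ is allowed). The losses $f_k:\mathbb R^{m\times n}\to\mathbb R$ are convex, $1$-Lipschitz for the Frobenius norm, and differentiable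 at $W_k$. Let $W_*\in\mathbb R^{m\times n}$, let $D$ satisfy $\|W_k-W_*\|_F\le D$ for $1\le k\le K$, let $R(K)=\sum_{k=1}^K\bigl(f_k(W_k)-f_k(W_*)\bigr)$ be the regret, and let $K'=|\{1,\dots,K\}\setminus\mathcal I|$ be the number of iterations in which $R_k$ is updated. (1) There is a constant $C>0$ that depends only on $m,n,L_0,R_0$ such that, for all such runs and all $K$ with $K'\ge1$, $$R(K)\le C\Bigl(\frac{D^2}{\eta}+\eta\Bigr)\sqrt{KK'}.$$ In particular, for fixed $D$ and $\eta$, the regret is at most $O(\sqrt{KK'})$ whenever $K'=K'(K)\ge 1$ and $K'=o(K)$. (2) Let $\varepsilon\ge0$ and let $K'(\cdot)$ be a sequence of natural numbers with $K'(K)=\Theta(K^{2\varepsilon})$ as $K\to\infty$ (in particular if $K'(K)\sim K^{2\varepsilon}$). Then there is a constant $C>0$ that depends only on $m,n,L_0,R_0,\varepsilon$ and the sequence $K'(\cdot)$ such that, for all $K\ge1$ and all such runs over $K$ iterations in which $R_k$ is updated exactly $K'(K)$ times, $$R(K)\le C\Bigl(\frac{D^2}{\eta}+\eta\Bigr)K^{1/2+\varepsilon}.$$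 -/

import Mathlib

open scoped Matrix
open Asymptotics Filter

noncomputable section

namespace KrADagrad

/-- The space of vectorized parameters `w = vec W ∈ ℝ^{mn}`, `W ∈ ℝ^{m × n}`, with the Euclidean
norm. The entry with index `(j, i)` is the entry of `W` in row `i` and column `j`. -/
abbrev Param (m n : ℕ) : Type := EuclideanSpace ℝ (Fin n × Fin m)

/-- Column-stacking vectorization of a matrix. -/
def toVec {m n : ℕ} (A : Matrix (Fin m) (Fin n) ℝ) : Param m n :=
  WithLp.toLp 2 (Matrix.vec A)

/-- Inverse of the vectorization. -/
def ofVec {m n : ℕ} (a : Param m n) : Matrix (Fin m) (Fin n) ℝ :=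
  Matrix.of fun i j => a (j, i)

theorem ofVec_toVec {m n : ℕ} (A : Matrix (Fin m) (Fin n) ℝ) : ofVec (toVec A) = A := rfl

theorem toVec_ofVec {m n : ℕ} (a : Param m n) : toVec (ofVec a) = a := rfl

/-- Spectral norm of a square matrix: the operator norm for the Euclidean norm. -/
def specNorm {p : ℕ} (A : Matrix (Fin p) (Fin p) ℝ) : ℝ :=
  ‖Matrix.toEuclideanCLM (n := Fin p) (𝕜 := ℝ) A‖

/-- Frobenius norm. -/
def frobNorm {p : ℕ} (A : Matrix (Fin p) (Fin p) ℝ) : ℝ :=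
  Real.sqrt (Matrix.trace (Aᵀ * A))

/-- The square root `V Λ^{1/2} Vᵀ` of a positive semidefinite matrix `V Λ Vᵀ`. -/
def half {p : ℕ} (A : Matrix (Fin p) (Fin p) ℝ) : Matrix (Fin p) (Fin p) ℝ :=
  cfc Real.sqrt A

/-- `t` is the normalization `1 + ‖A G B Gᵀ‖`, in the spectral or in the Frobenius norm. -/
def IsNormalizer {p q : ℕ} (A : Matrix (Fin p) (Fin p) ℝ) (B : Matrix (Fin q) (Fin q) ℝ)
    (G : Matrix (Fin p) (Fin q) ℝ) (t : ℝ) : Prop :=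
  t = 1 + specNorm (A * G * B * Gᵀ) ∨ t = 1 + frobNorm (A * G * B * Gᵀ)

/-- The statistic `A - t⁻¹ A G B Gᵀ A` that replaces `A` when `B` is held constant. -/
def update {p q : ℕ} (A : Matrix (Fin p) (Fin p) ℝ) (B : Matrix (Fin q) (Fin q) ℝ)
    (G : Matrix (Fin p) (Fin q) ℝ) (t : ℝ) : Matrix (Fin p) (Fin p) ℝ :=
  A - t⁻¹ • (A * G * B * Gᵀ * A)

/-- `K` iterations of KrADagrad with exponent `1/2`, update set `I`, constant step size `η`, losses
`f k` and initial statistics `L₀`, `R₀`. Iteration `k` (with `1 ≤ k ≤ K`) starts from the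
parameters `w k` and the statistics `L (k - 1)`, `R (k - 1)`. It observes the gradient `g k` of
`f k` at `w k`, updates `L` if `k ∈ I` and `R` otherwise, and takes the step from `w k` to
`w (k + 1)` that is preconditioned by the new statistics. The initial parameters are `w 1`. When
`R` is updated, the normalization may be the same expression as for `L` or its mirror image. -/
structure IsRun {m n : ℕ} (K : ℕ) (I : Set ℕ) (η : ℝ) (f : ℕ → Param m n → ℝ)
    (L₀ : Matrix (Fin m) (Fin m) ℝ) (R₀ : Matrix (Fin n) (Fin n) ℝ)
    (w g : ℕ → Param m n) (L : ℕ → Matrix (Fin m) (Fin m) ℝ)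
    (R : ℕ → Matrix (Fin n) (Fin n) ℝ) (t : ℕ → ℝ) : Prop where
  init_left : L 0 = L₀
  init_right : R 0 = R₀
  gradient : ∀ k ∈ Set.Icc 1 K, HasGradientAt (f k) (g k) (w k)
  update_left : ∀ k ∈ Set.Icc 1 K, k ∈ I →
    IsNormalizer (L (k - 1)) (R (k - 1)) (ofVec (g k)) (t k) ∧
    L k = update (L (k - 1)) (R (k - 1)) (ofVec (g k)) (t k) ∧
    R k = R (k - 1)
  update_right : ∀ k ∈ Set.Icc 1 K, k ∉ I →
    (IsNormalizer (L (k - 1)) (R (k - 1)) (ofVec (g k)) (t k) ∨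
      IsNormalizer (R (k - 1)) (L (k - 1)) (ofVec (g k))ᵀ (t k)) ∧
    L k = L (k - 1) ∧
    R k = update (R (k - 1)) (L (k - 1)) (ofVec (g k))ᵀ (t k)
  step : ∀ k ∈ Set.Icc 1 K,
    w (k + 1) = w k - η • toVec (half (L k) * ofVec (g k) * half (R k))

/-- The number `K'` of iterations among the first `K` in which `R` is updated. -/
def numRight (I : Set ℕ) (K : ℕ) : ℕ := (Set.Icc 1 K \ I).ncard

/-- The regret after `K` iterations against the fixed comparator `wstar`. -/
def regret {m n : ℕ} (K : ℕ) (f : ℕ → Param m n → ℝ) (w : ℕ → Param m n)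
    (wstar : Param m n) : ℝ :=
  ∑ k ∈ Finset.Icc 1 K, (f k (w k) - f k wstar)

/-- The data of `K` iterations of KrADagrad as the regret bound sees them: convex losses that are
1-Lipschitz for the Euclidean norm of `vec W` (the Frobenius norm of `W`), a positive constant step
size, and a bound `D` on the distance of the iterates to the comparator. -/
structure IsOnlineRun {m n : ℕ} (K : ℕ) (I : Set ℕ) (η D : ℝ) (f : ℕ → Param m n → ℝ)
    (L₀ : Matrix (Fin m) (Fin m) ℝ) (R₀ : Matrix (Fin n) (Fin n) ℝ)
    (w g : ℕ → Param m n) (L : ℕ → Matrix (Fin m) (Fin m) ℝ)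
    (R : ℕ → Matrix (Fin n) (Fin n) ℝ) (t : ℕ → ℝ) (wstar : Param m n) : Prop where
  run : IsRun K I η f L₀ R₀ w g L R t
  step_pos : 0 < η
  convex : ∀ k ∈ Set.Icc 1 K, ConvexOn ℝ Set.univ (f k)
  lipschitz : ∀ k ∈ Set.Icc 1 K, LipschitzWith 1 (f k)
  dist_le : ∀ k ∈ Set.Icc 1 K, ‖w k - wstar‖ ≤ D

end KrADagrad

end

/-! This is the online mirror descent argument of AdaGrad in the metric given by `S = L^{-1/2}` and
`T = R^{-1/2}`, with potential `tr S · tr T` (`potential`).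

Put `V = G R^{1/2}`. By the Woodbury identity an update of `L` adds `t⁻¹ V F⁻¹ Vᵀ` to `L⁻¹`, where
`F = 1 - t⁻¹ Vᵀ L V`. The normalization makes `t - 1` an upper bound for `Vᵀ L V`, so `t⁻¹ ≤ F ≤ 1`,
and the increment of `L⁻¹` lies between `t⁻¹ G R Gᵀ` and `G R Gᵀ` (`posDef_update`).

The lower bound pays for the step. Concavity of `tr √·` bounds the energy `tr(Gᵀ L^{1/2} G R^{1/2})`
by `2t` times the increase of the potential (`trace_step_le`). The traces of `L` and `R` never
increase and gradients have norm at most 1, so `t ≤ 1 + tr L₀ · tr R₀`. Changing the metric costs at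
most `D²` times the same increase (`weighted_le`). Both costs telescope, and the regret is at most a
constant times `(D²/η + η)` times the final potential (`IsOnlineRun.regret_le_potential`).

The upper bound makes `tr L⁻¹` grow at most linearly in `K` and `tr R⁻¹` at most linearly in `K'`.
By Cauchy–Schwarz the final potential is then `O(√((1 + K)(1 + K')))` (`StatBounds.potential_le`).
-/

namespace KrADagrad

/-! ### Loewner order, traces and square roots of real positive semidefinite matrices. -/

section PosSemidef

variable {p q : ℕ}

theorem posSemidef_of_eigenvalues_nonneg {A : Matrix (Fin p) (Fin p) ℝ} (hA : A.IsHermitian)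
    (h : ∀ (μ : ℝ) (v : Fin p → ℝ), v ≠ 0 → A *ᵥ v = μ • v → 0 ≤ μ) : A.PosSemidef := by
  rw [hA.posSemidef_iff_eigenvalues_nonneg]
  intro i
  refine h _ (⇑(hA.eigenvectorBasis i)) ?_ (hA.mulVec_eigenvectorBasis i)
  exact (WithLp.ofLp_eq_zero 2).ne.2 <| hA.eigenvectorBasis.orthonormal.ne_zero i

theorem dotProduct_nonneg {A : Matrix (Fin p) (Fin p) ℝ} (hA : A.PosSemidef) (v : Fin p → ℝ) :
    0 ≤ v ⬝ᵥ A *ᵥ v := by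
  simpa using hA.dotProduct_mulVec_nonneg v

theorem dotProduct_pos {A : Matrix (Fin p) (Fin p) ℝ} (hA : A.PosDef) {v : Fin p → ℝ}
    (hv : v ≠ 0) : 0 < v ⬝ᵥ A *ᵥ v := by
  simpa using hA.dotProduct_mulVec_pos hv

theorem transpose_eq {A : Matrix (Fin p) (Fin p) ℝ} (hA : A.PosSemidef) : Aᵀ = A := by
  simpa using hA.isHermitian.eq

theorem posSemidef_conj {A : Matrix (Fin p) (Fin p) ℝ} (hA : A.PosSemidef)
    (B : Matrix (Fin q) (Fin p) ℝ) : (B * A * Bᵀ).PosSemidef := by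
  simpa using hA.mul_mul_conjTranspose_same B

theorem posSemidef_conj' {A : Matrix (Fin p) (Fin p) ℝ} (hA : A.PosSemidef)
    (B : Matrix (Fin p) (Fin q) ℝ) : (Bᵀ * A * B).PosSemidef := by
  simpa using hA.conjTranspose_mul_mul_same B

theorem posSemidef_mul_transpose (B : Matrix (Fin p) (Fin q) ℝ) : (B * Bᵀ).PosSemidef := by
  simpa using Matrix.posSemidef_self_mul_conjTranspose B

theorem posSemidef_half {A : Matrix (Fin p) (Fin p) ℝ} : (half A).PosSemidef := by
  open scoped MatrixOrder in
  rw [← Matrix.nonneg_iff_posSemidef]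
  exact cfc_nonneg fun x _ => Real.sqrt_nonneg x

theorem half_mul_half {A : Matrix (Fin p) (Fin p) ℝ} (hA : A.PosSemidef) :
    half A * half A = A := by
  have hs : IsSelfAdjoint A := hA.isHermitian
  unfold half
  rw [← cfc_mul Real.sqrt Real.sqrt A]
  conv_rhs => rw [← cfc_id ℝ A hs]
  refine cfc_congr fun x hx => ?_
  rw [hA.isHermitian.spectrum_real_eq_range_eigenvalues] at hx
  obtain ⟨i, rfl⟩ := hx
  exact Real.mul_self_sqrt (hA.eigenvalues_nonneg i)

theorem posDef_half {A : Matrix (Fin p) (Fin p) ℝ} (hA : A.PosDef) : (half A).PosDef := by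
  rw [posSemidef_half.posDef_iff_isUnit]
  have h : IsUnit (half A * half A) := by
    rw [half_mul_half hA.posSemidef]; exact hA.isUnit
  rw [Matrix.isUnit_iff_isUnit_det, Matrix.det_mul] at h
  rw [Matrix.isUnit_iff_isUnit_det]
  exact isUnit_of_mul_isUnit_left h

theorem trace_mul_nonneg {A B : Matrix (Fin p) (Fin p) ℝ} (hA : A.PosSemidef)
    (hB : B.PosSemidef) : 0 ≤ (A * B).trace := by
  have h : (A * B).trace = ((half B)ᵀ * A * half B).trace := by
    rw [transpose_eq posSemidef_half, mul_assoc, Matrix.trace_mul_comm (half B), mul_assoc,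
      half_mul_half hB]
  rw [h]
  exact (posSemidef_conj' hA _).trace_nonneg

/-- Cauchy–Schwarz for each row of `A^{1/2}`: the quadratic form at `v` is the sum of the squared
products of these rows with `v`, and the trace is the sum of their squared lengths. -/
theorem posSemidef_trace_smul_one_sub {A : Matrix (Fin p) (Fin p) ℝ} (hA : A.PosSemidef) :
    (A.trace • (1 : Matrix (Fin p) (Fin p) ℝ) - A).PosSemidef := by
  refine posSemidef_of_eigenvalues_nonneg ?_ ?_
  · refine Matrix.IsHermitian.sub ?_ hA.isHermitian
    simp [Matrix.IsHermitian]
  · intro μ v hv h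
    have hvv : 0 < v ⬝ᵥ v := by
      simpa using dotProduct_pos (Matrix.PosDef.one (n := Fin p) (R := ℝ)) hv
    have h1 : v ⬝ᵥ A *ᵥ v ≤ A.trace * (v ⬝ᵥ v) := by
      have hH := half_mul_half hA
      have hT := transpose_eq (posSemidef_half (A := A))
      have e1 : v ⬝ᵥ A *ᵥ v = ∑ i, (half A i ⬝ᵥ v) ^ 2 := by
        conv_lhs => rw [← hH, ← Matrix.mulVec_mulVec, Matrix.dotProduct_mulVec,
          ← Matrix.mulVec_transpose, hT]
        simp [dotProduct, Matrix.mulVec, sq]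
      have e2 : A.trace = ∑ i, half A i ⬝ᵥ half A i := by
        conv_lhs => rw [← hH]
        conv_lhs => enter [1, 2]; rw [← hT]
        simp [Matrix.trace, Matrix.mul_apply, dotProduct]
      rw [e1, e2, Finset.sum_mul]
      refine Finset.sum_le_sum fun i _ => ?_
      have := Finset.sum_mul_sq_le_sq_mul_sq Finset.univ (half A i) v
      simpa [dotProduct, sq] using this
    have h2 : v ⬝ᵥ (A.trace • (1 : Matrix (Fin p) (Fin p) ℝ) - A) *ᵥ v = μ * (v ⬝ᵥ v) := by
      rw [h]; simp
    rw [Matrix.sub_mulVec, dotProduct_sub, Matrix.smul_mulVec, Matrix.one_mulVec,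
      dotProduct_smul, smul_eq_mul] at h2
    by_contra hμ
    nlinarith

theorem trace_mul_le {A B : Matrix (Fin p) (Fin p) ℝ} (hA : A.PosSemidef)
    (hB : B.PosSemidef) : (A * B).trace ≤ A.trace * B.trace := by
  have h := trace_mul_nonneg (posSemidef_trace_smul_one_sub hA) hB
  rw [Matrix.sub_mul, Matrix.trace_sub, Matrix.smul_mul, Matrix.one_mul, Matrix.trace_smul,
    smul_eq_mul] at h
  linarith

/-- Squaring reflects the Loewner order. -/
theorem posSemidef_sub_of_sq {X Y : Matrix (Fin p) (Fin p) ℝ} (hX : X.PosDef) (hY : Y.PosSemidef)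
    (h : (X * X - Y * Y).PosSemidef) : (X - Y).PosSemidef := by
  refine posSemidef_of_eigenvalues_nonneg (hX.isHermitian.sub hY.isHermitian) ?_
  intro μ v hv hμ
  by_contra hneg
  push Not at hneg
  have hXv : 0 < v ⬝ᵥ X *ᵥ v := dotProduct_pos hX hv
  -- On an eigenvector of `X - Y` with `μ < 0`, `|Yv|² = |Xv|² - 2μ v·Xv + μ²|v|²` exceeds `|Xv|²`,
  -- against the hypothesis on the squares.
  have hYv : Y *ᵥ v = X *ᵥ v - μ • v := by
    rw [← hμ, Matrix.sub_mulVec]; abel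
  have sq_form : ∀ Z : Matrix (Fin p) (Fin p) ℝ, Zᵀ = Z →
      v ⬝ᵥ (Z * Z) *ᵥ v = (Z *ᵥ v) ⬝ᵥ (Z *ᵥ v) := by
    intro Z hZ
    rw [← Matrix.mulVec_mulVec, Matrix.dotProduct_mulVec, ← Matrix.mulVec_transpose, hZ]
  have h1 := dotProduct_nonneg h v
  rw [Matrix.sub_mulVec, dotProduct_sub, sq_form X (transpose_eq hX.posSemidef),
    sq_form Y (transpose_eq hY), hYv] at h1
  have h2 : (X *ᵥ v - μ • v) ⬝ᵥ (X *ᵥ v - μ • v)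
      = (X *ᵥ v) ⬝ᵥ (X *ᵥ v) - 2 * μ * (v ⬝ᵥ X *ᵥ v) + μ ^ 2 * (v ⬝ᵥ v) := by
    simp only [sub_dotProduct, dotProduct_sub, smul_dotProduct, dotProduct_smul, smul_eq_mul,
      dotProduct_comm (X *ᵥ v) v]
    ring
  have h3 : 0 ≤ v ⬝ᵥ v := by
    simpa using dotProduct_nonneg (Matrix.PosSemidef.one (n := Fin p) (R := ℝ)) v
  rw [h2] at h1
  nlinarith [mul_pos_of_neg_of_neg hneg (neg_neg_of_pos hXv), mul_nonneg (sq_nonneg μ) h3]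

theorem mul_inv_cancel_posDef {A : Matrix (Fin p) (Fin p) ℝ} (hA : A.PosDef) : A * A⁻¹ = 1 :=
  Matrix.mul_nonsing_inv A ((Matrix.isUnit_iff_isUnit_det A).1 hA.isUnit)

theorem inv_mul_cancel_posDef {A : Matrix (Fin p) (Fin p) ℝ} (hA : A.PosDef) : A⁻¹ * A = 1 :=
  Matrix.nonsing_inv_mul A ((Matrix.isUnit_iff_isUnit_det A).1 hA.isUnit)

/-- Inversion reverses the Loewner order. -/
theorem posSemidef_inv_sub_inv {A B : Matrix (Fin p) (Fin p) ℝ} (hA : A.PosDef) (hB : B.PosDef)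
    (h : (B - A).PosSemidef) : (A⁻¹ - B⁻¹).PosSemidef := by
  have hAA : A * A⁻¹ = 1 := mul_inv_cancel_posDef hA
  have hAA' : A⁻¹ * A = 1 := inv_mul_cancel_posDef hA
  have hBB' : B⁻¹ * B = 1 := inv_mul_cancel_posDef hB
  -- Both summands are congruences of positive semidefinite matrices, so no square roots are needed.
  have e : A⁻¹ - B⁻¹ = (A⁻¹ - B⁻¹) * A * (A⁻¹ - B⁻¹)ᵀ + B⁻¹ * (B - A) * (B⁻¹)ᵀ := by
    rw [Matrix.transpose_sub, transpose_eq hA.inv.posSemidef, transpose_eq hB.inv.posSemidef]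
    simp only [Matrix.sub_mul, Matrix.mul_sub, hAA', hBB', Matrix.one_mul, Matrix.mul_assoc, hAA]
    rw [Matrix.mul_one]
    abel
  rw [e]
  exact (posSemidef_conj hA.posSemidef _).add (posSemidef_conj h _)

end PosSemidef

/-! ### Comparison of the spectral norm, the Frobenius norm and traces. -/

section Norms

variable {p : ℕ}

theorem abs_eigenvalue_le_specNorm {A : Matrix (Fin p) (Fin p) ℝ} {μ : ℝ} {v : Fin p → ℝ}
    (hv : v ≠ 0) (h : A *ᵥ v = μ • v) : |μ| ≤ specNorm A := by
  have h1 := (Matrix.toEuclideanCLM (n := Fin p) (𝕜 := ℝ) A).le_opNorm (WithLp.toLp 2 v)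
  rw [Matrix.toEuclideanCLM_toLp, h, WithLp.toLp_smul, norm_smul, Real.norm_eq_abs] at h1
  exact le_of_mul_le_mul_right h1 (norm_pos_iff.2 ((WithLp.toLp_eq_zero 2).ne.2 hv))

theorem specNorm_le_frobNorm (A : Matrix (Fin p) (Fin p) ℝ) : specNorm A ≤ frobNorm A := by
  refine ContinuousLinearMap.opNorm_le_bound _ (Real.sqrt_nonneg _) fun x => ?_
  have hA : (Aᵀ * A).PosSemidef := by simpa using posSemidef_mul_transpose Aᵀ
  rw [frobNorm, EuclideanSpace.norm_eq, EuclideanSpace.norm_eq, ← Real.sqrt_mul hA.trace_nonneg]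
  refine Real.sqrt_le_sqrt ?_
  have h := dotProduct_nonneg (posSemidef_trace_smul_one_sub hA) x.ofLp
  rw [Matrix.sub_mulVec, dotProduct_sub, Matrix.smul_mulVec, Matrix.one_mulVec,
      dotProduct_smul, smul_eq_mul, ← Matrix.mulVec_mulVec, Matrix.dotProduct_mulVec,
      ← Matrix.mulVec_transpose, Matrix.transpose_transpose] at h
  simpa [dotProduct, sq] using h

/-- The squared norm is `tr(A² B²)` by cyclicity, and `trace_mul_le` splits it three times. This
bounds either choice of normalization from above. -/
theorem frobNorm_mul_le {A B : Matrix (Fin p) (Fin p) ℝ} (hA : A.PosSemidef)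
    (hB : B.PosSemidef) : frobNorm (A * B) ≤ A.trace * B.trace := by
  have e : ((A * B)ᵀ * (A * B)).trace = ((A * A) * (B * B)).trace := by
    rw [Matrix.transpose_mul, transpose_eq hA, transpose_eq hB, Matrix.trace_mul_comm,
      Matrix.mul_assoc, ← Matrix.mul_assoc B, Matrix.trace_mul_comm, Matrix.mul_assoc,
      Matrix.trace_mul_comm]
  have sq_psd : ∀ {Z : Matrix (Fin p) (Fin p) ℝ}, Z.PosSemidef → (Z * Z).PosSemidef := by
    intro Z hZ
    have := posSemidef_mul_transpose Z
    rwa [transpose_eq hZ] at this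
  rw [frobNorm, e]
  refine Real.sqrt_le_iff.2 ⟨mul_nonneg hA.trace_nonneg hB.trace_nonneg, ?_⟩
  calc ((A * A) * (B * B)).trace ≤ (A * A).trace * (B * B).trace :=
        trace_mul_le (sq_psd hA) (sq_psd hB)
    _ ≤ (A.trace * A.trace) * (B.trace * B.trace) :=
        mul_le_mul (trace_mul_le hA hA) (trace_mul_le hB hB) (sq_psd hB).trace_nonneg
          (mul_nonneg hA.trace_nonneg hA.trace_nonneg)
    _ = (A.trace * B.trace) ^ 2 := by ring

end Norms

end KrADagrad
namespace KrADagrad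

/-! ### The inverse of an updated statistic. -/

section Update

variable {p q : ℕ} {A : Matrix (Fin p) (Fin p) ℝ} {B : Matrix (Fin q) (Fin q) ℝ}
  {G : Matrix (Fin p) (Fin q) ℝ} {t : ℝ}

/-- The matrix `B^{1/2} Gᵀ A G B^{1/2}`, whose nonzero eigenvalues are those of `A G B Gᵀ`. -/
noncomputable def core (A : Matrix (Fin p) (Fin p) ℝ) (B : Matrix (Fin q) (Fin q) ℝ)
    (G : Matrix (Fin p) (Fin q) ℝ) : Matrix (Fin q) (Fin q) ℝ :=
  (G * half B)ᵀ * A * (G * half B)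

theorem mul_half_mul_transpose (hB : B.PosSemidef) (G : Matrix (Fin p) (Fin q) ℝ) :
    (G * half B) * (G * half B)ᵀ = G * B * Gᵀ := by
  rw [Matrix.transpose_mul, transpose_eq posSemidef_half, Matrix.mul_assoc,
    ← Matrix.mul_assoc (half B), half_mul_half hB, Matrix.mul_assoc]

theorem posSemidef_core (hA : A.PosSemidef) : (core A B G).PosSemidef :=
  posSemidef_conj' hA _

/-- Nonzero eigenvalues of `X Y` are eigenvalues of `Y X`. -/
theorem eigenvalue_mul_comm {X : Matrix (Fin p) (Fin q) ℝ} {Y : Matrix (Fin q) (Fin p) ℝ}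
    {μ : ℝ} {v : Fin p → ℝ} (hv : v ≠ 0) (hμ : μ ≠ 0) (h : (X * Y) *ᵥ v = μ • v) :
    Y *ᵥ v ≠ 0 ∧ (Y * X) *ᵥ (Y *ᵥ v) = μ • (Y *ᵥ v) := by
  constructor
  · intro h0
    rw [← Matrix.mulVec_mulVec, h0, Matrix.mulVec_zero] at h
    exact (smul_ne_zero hμ hv) h.symm
  · rw [Matrix.mulVec_mulVec, Matrix.mul_assoc, ← Matrix.mulVec_mulVec, h, Matrix.mulVec_smul]

/-- Only nonzero eigenvalues are tested, because those are the ones that `core` shares with the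
non-symmetric product inside the normalization. -/
theorem posSemidef_smul_one_sub_core {s : ℝ} (hA : A.PosSemidef)
    (h : ∀ (μ : ℝ) (v : Fin q → ℝ), v ≠ 0 → μ ≠ 0 → core A B G *ᵥ v = μ • v → |μ| ≤ s)
    (hs : 0 ≤ s) : (s • (1 : Matrix (Fin q) (Fin q) ℝ) - core A B G).PosSemidef := by
  refine posSemidef_of_eigenvalues_nonneg ?_ ?_
  · refine Matrix.IsHermitian.sub ?_ (posSemidef_core hA).isHermitian
    simp [Matrix.IsHermitian]
  · intro μ v hv hμ
    have e : core A B G *ᵥ v = (s - μ) • v := by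
      rw [sub_smul, ← hμ, Matrix.sub_mulVec, Matrix.smul_mulVec, Matrix.one_mulVec]; abel
    by_cases h0 : s - μ = 0
    · linarith
    · linarith [le_abs_self (s - μ), h _ v hv h0 e]

theorem specNorm_nonneg (A : Matrix (Fin p) (Fin p) ℝ) : 0 ≤ specNorm A := norm_nonneg _

theorem IsNormalizer.specNorm_le (ht : IsNormalizer A B G t) :
    specNorm (A * G * B * Gᵀ) ≤ t - 1 := by
  rcases ht with rfl | rfl
  · simp
  · simpa using specNorm_le_frobNorm _

theorem IsNormalizer.le (ht : IsNormalizer A B G t) (hA : A.PosSemidef) (hB : B.PosSemidef) :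
    t ≤ 1 + A.trace * (G * B * Gᵀ).trace := by
  have h : frobNorm (A * G * B * Gᵀ) ≤ A.trace * (G * B * Gᵀ).trace := by
    have := frobNorm_mul_le hA (posSemidef_conj hB G)
    simpa only [Matrix.mul_assoc] using this
  rcases ht with rfl | rfl
  · linarith [specNorm_le_frobNorm (A * G * B * Gᵀ)]
  · linarith

theorem IsNormalizer.one_le (ht : IsNormalizer A B G t) : 1 ≤ t := by
  linarith [ht.specNorm_le, specNorm_nonneg (A * G * B * Gᵀ)]

theorem IsNormalizer.posSemidef_sub_core (ht : IsNormalizer A B G t) (hA : A.PosSemidef)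
    (hB : B.PosSemidef) :
    ((t - 1) • (1 : Matrix (Fin q) (Fin q) ℝ) - core A B G).PosSemidef := by
  refine posSemidef_smul_one_sub_core hA (fun μ v hv hμ h => ?_) (by linarith [ht.one_le])
  rw [core, Matrix.mul_assoc] at h
  obtain ⟨h1, h2⟩ := eigenvalue_mul_comm hv hμ h
  rw [Matrix.mul_assoc, mul_half_mul_transpose hB] at h2
  refine le_trans (abs_eigenvalue_le_specNorm h1 ?_) ht.specNorm_le
  rw [← h2]
  simp only [Matrix.mul_assoc]

/-- Covers an update of `R` normalized by the expression for `L`: moving one factor `B^{1/2}` around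
the product shows that `core` has the same nonzero eigenvalues as `B G A Gᵀ`. -/
theorem IsNormalizer.posSemidef_sub_core_transpose {G : Matrix (Fin q) (Fin p) ℝ}
    (ht : IsNormalizer B A G t) (hA : A.PosSemidef) (hB : B.PosSemidef) :
    ((t - 1) • (1 : Matrix (Fin q) (Fin q) ℝ) - core A B Gᵀ).PosSemidef := by
  refine posSemidef_smul_one_sub_core hA (fun μ v hv hμ h => ?_) (by linarith [ht.one_le])
  have e : core A B Gᵀ = half B * (G * A * Gᵀ * half B) := by
    simp only [core, Matrix.transpose_mul, Matrix.transpose_transpose,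
      transpose_eq (posSemidef_half (A := B)), Matrix.mul_assoc]
  rw [e, ← Matrix.mul_assoc] at h
  obtain ⟨h1, h2⟩ := eigenvalue_mul_comm hv hμ h
  rw [← Matrix.mul_assoc, half_mul_half hB] at h2
  refine le_trans (abs_eigenvalue_le_specNorm h1 ?_) ht.specNorm_le
  rw [← h2]
  simp only [Matrix.mul_assoc]

theorem inv_smul_one (ht : t ≠ 0) :
    (t⁻¹ • (1 : Matrix (Fin q) (Fin q) ℝ))⁻¹ = t • (1 : Matrix (Fin q) (Fin q) ℝ) :=
  Matrix.inv_eq_right_inv (by simp [smul_smul, mul_inv_cancel₀ ht])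

/-- Loewner bounds for the inverse of the updated statistic. -/
theorem posDef_update (hA : A.PosDef) (hB : B.PosSemidef) (ht : 1 ≤ t)
    (hc : ((t - 1) • (1 : Matrix (Fin q) (Fin q) ℝ) - core A B G).PosSemidef) :
    (update A B G t).PosDef ∧
      ((update A B G t)⁻¹ - A⁻¹ - t⁻¹ • (G * B * Gᵀ)).PosSemidef ∧
      (A⁻¹ + G * B * Gᵀ - (update A B G t)⁻¹).PosSemidef := by
  have t0 : 0 < t := by linarith
  have ti : 0 < t⁻¹ := inv_pos.2 t0
  set V := G * half B with hV
  have hVV : V * Vᵀ = G * B * Gᵀ := mul_half_mul_transpose hB G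
  set F : Matrix (Fin q) (Fin q) ℝ := 1 - t⁻¹ • core A B G with hF
  have hone : (t⁻¹ • (1 : Matrix (Fin q) (Fin q) ℝ)).PosDef := Matrix.PosDef.one.smul ti
  -- The leading 1 in the normalization matters here: `1 - (t - 1)/t = 1/t` keeps `F` away from
  -- singularity.
  have hlow : (F - t⁻¹ • (1 : Matrix (Fin q) (Fin q) ℝ)).PosSemidef := by
    have e : F - t⁻¹ • (1 : Matrix (Fin q) (Fin q) ℝ)
        = t⁻¹ • ((t - 1) • (1 : Matrix (Fin q) (Fin q) ℝ) - core A B G) := by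
      rw [hF, smul_sub, smul_smul, mul_sub, inv_mul_cancel₀ t0.ne', sub_smul, one_smul, mul_one]
      abel
    rw [e]
    exact hc.smul ti.le
  have hFpd : F.PosDef := by
    have := hone.add_posSemidef hlow
    simpa using this
  have hup : ((1 : Matrix (Fin q) (Fin q) ℝ) - F).PosSemidef := by
    rw [hF, sub_sub_cancel]
    exact (posSemidef_core hA.posSemidef).smul ti.le
  have hFi1 : (F⁻¹ - 1).PosSemidef := by
    have := posSemidef_inv_sub_inv hFpd Matrix.PosDef.one hup
    simpa using this
  have hFi2 : (t • (1 : Matrix (Fin q) (Fin q) ℝ) - F⁻¹).PosSemidef := by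
    have := posSemidef_inv_sub_inv hone hFpd hlow
    rwa [inv_smul_one t0.ne'] at this
  have hcore : core A B G = Vᵀ * A * V := rfl
  have hupd : update A B G t = A - t⁻¹ • (A * V * (Vᵀ * A)) := by
    rw [update]
    congr 2
    rw [← Matrix.mul_assoc, Matrix.mul_assoc A V, hVV, ← Matrix.mul_assoc, ← Matrix.mul_assoc]
  -- The Woodbury identity, checked by multiplying out; it reduces to `F F⁻¹ = 1`.
  have hinv : (update A B G t) * (A⁻¹ + t⁻¹ • (V * F⁻¹ * Vᵀ)) = 1 := by
    have hFF : F * F⁻¹ = 1 := mul_inv_cancel_posDef hFpd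
    have h1 : F⁻¹ - t⁻¹ • (Vᵀ * A * V * F⁻¹) = 1 := by
      rw [← hFF]
      nth_rewrite 3 [hF]
      rw [hcore, Matrix.sub_mul, Matrix.one_mul, Matrix.smul_mul]
    have hAA : A * A⁻¹ = 1 := mul_inv_cancel_posDef hA
    rw [hupd]
    have e1 : (A - t⁻¹ • (A * V * (Vᵀ * A))) * (A⁻¹ + t⁻¹ • (V * F⁻¹ * Vᵀ))
        = A * A⁻¹ - t⁻¹ • (A * V * (Vᵀ * (A * A⁻¹)))
          + t⁻¹ • (A * V * (F⁻¹ - t⁻¹ • (Vᵀ * A * V * F⁻¹)) * Vᵀ) := by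
      simp only [Matrix.sub_mul, Matrix.mul_add, Matrix.mul_sub, Matrix.smul_mul, Matrix.mul_smul,
        smul_sub, Matrix.mul_assoc]
    rw [e1, h1, hAA]
    simp
  have hI : (update A B G t)⁻¹ = A⁻¹ + t⁻¹ • (V * F⁻¹ * Vᵀ) := Matrix.inv_eq_right_inv hinv
  have hIpd : (A⁻¹ + t⁻¹ • (V * F⁻¹ * Vᵀ)).PosDef :=
    hA.inv.add_posSemidef ((posSemidef_conj hFpd.inv.posSemidef V).smul ti.le)
  refine ⟨?_, ?_, ?_⟩
  · have : ((update A B G t)⁻¹).PosDef := by rw [hI]; exact hIpd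
    exact Matrix.posDef_inv_iff.1 this
  · rw [hI, ← hVV]
    have e : A⁻¹ + t⁻¹ • (V * F⁻¹ * Vᵀ) - A⁻¹ - t⁻¹ • (V * Vᵀ)
        = t⁻¹ • (V * (F⁻¹ - 1) * Vᵀ) := by
      rw [Matrix.mul_sub, Matrix.sub_mul, Matrix.mul_one, smul_sub]; abel
    rw [e]
    exact (posSemidef_conj hFi1 V).smul ti.le
  · rw [hI, ← hVV]
    have e : A⁻¹ + V * Vᵀ - (A⁻¹ + t⁻¹ • (V * F⁻¹ * Vᵀ))
        = t⁻¹ • (V * (t • (1 : Matrix (Fin q) (Fin q) ℝ) - F⁻¹) * Vᵀ) := by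
      rw [Matrix.mul_sub, Matrix.sub_mul, smul_sub, Matrix.mul_smul, Matrix.smul_mul, smul_smul,
        inv_mul_cancel₀ t0.ne', Matrix.mul_one, one_smul]
      abel
    rw [e]
    exact (posSemidef_conj hFi2 V).smul ti.le

theorem trace_update_le (hA : A.PosSemidef) (hB : B.PosSemidef) (ht : 1 ≤ t) :
    (update A B G t).trace ≤ A.trace := by
  have h := posSemidef_conj (posSemidef_conj hB G) A
  rw [transpose_eq hA] at h
  have e : A * (G * B * Gᵀ) * A = A * G * B * Gᵀ * A := by simp only [Matrix.mul_assoc]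
  rw [e] at h
  rw [update, Matrix.trace_sub, Matrix.trace_smul, smul_eq_mul]
  have := mul_nonneg (inv_nonneg.2 (by linarith : (0 : ℝ) ≤ t)) h.trace_nonneg
  linarith

end Update

/-! ### Inverse square roots and the energy of a step. -/

section InverseRoot

variable {p q : ℕ}

/-- The inverse square root `A^{-1/2}`. -/
noncomputable def invHalf (A : Matrix (Fin p) (Fin p) ℝ) : Matrix (Fin p) (Fin p) ℝ := (half A)⁻¹

variable {A A' : Matrix (Fin p) (Fin p) ℝ} {B : Matrix (Fin q) (Fin q) ℝ}

theorem posDef_invHalf (hA : A.PosDef) : (invHalf A).PosDef := (posDef_half hA).inv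

theorem invHalf_mul_invHalf (hA : A.PosDef) : invHalf A * invHalf A = A⁻¹ := by
  rw [invHalf, ← Matrix.mul_inv_rev, half_mul_half hA.posSemidef]

theorem posSemidef_invHalf_sub (hA : A.PosDef) (hA' : A'.PosDef) (h : (A'⁻¹ - A⁻¹).PosSemidef) :
    (invHalf A' - invHalf A).PosSemidef := by
  refine posSemidef_sub_of_sq (posDef_invHalf hA') (posDef_invHalf hA).posSemidef ?_
  rwa [invHalf_mul_invHalf hA, invHalf_mul_invHalf hA']

/-- Concavity of the trace of the square root. -/
theorem trace_half_mul_sub_le (hA : A.PosDef) (hA' : A'.PosDef) :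
    (half A' * (A'⁻¹ - A⁻¹)).trace ≤ 2 * ((invHalf A').trace - (invHalf A).trace) := by
  have hP := posDef_half hA'
  have hPS : half A' * invHalf A' = 1 := mul_inv_cancel_posDef hP
  have hSP : invHalf A' * half A' = 1 := inv_mul_cancel_posDef hP
  set X := invHalf A' with hX
  set Y := invHalf A with hY
  have hXY : (X - Y)ᵀ = X - Y := by
    rw [Matrix.transpose_sub, transpose_eq (posDef_invHalf hA').posSemidef,
      transpose_eq (posDef_invHalf hA).posSemidef]
  have h := (posSemidef_conj hP.posSemidef (X - Y)).trace_nonneg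
  rw [hXY] at h
  -- Since `half A'` is the inverse of `X`, the nonnegative trace of `(X - Y) X⁻¹ (X - Y)` is the
  -- tangent inequality for `tr √·` at `A'⁻¹`.
  have e : (X - Y) * half A' * (X - Y) = X - Y - Y + Y * half A' * Y := by
    rw [Matrix.sub_mul X Y, hSP, Matrix.sub_mul, Matrix.mul_sub, Matrix.mul_sub,
      Matrix.mul_assoc Y (half A') X, hPS, Matrix.one_mul, Matrix.one_mul, Matrix.mul_one]
    abel
  rw [e, Matrix.trace_add, Matrix.trace_sub, Matrix.trace_sub] at h
  have e2 : (half A' * (A'⁻¹ - A⁻¹)).trace = X.trace - (Y * half A' * Y).trace := by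
    rw [← invHalf_mul_invHalf hA, ← invHalf_mul_invHalf hA', Matrix.mul_sub, Matrix.trace_sub,
      ← hX, ← hY, ← Matrix.mul_assoc, hPS, Matrix.one_mul, Matrix.mul_assoc Y,
      Matrix.trace_mul_comm Y, Matrix.mul_assoc]
  linarith

/-- Energy of a step in terms of the increase of the trace of the inverse root. -/
theorem trace_step_le {G : Matrix (Fin p) (Fin q) ℝ} {t : ℝ} (hA : A.PosDef) (hA' : A'.PosDef)
    (hB : B.PosDef) (ht : 0 < t) (h : (A'⁻¹ - A⁻¹ - t⁻¹ • (G * B * Gᵀ)).PosSemidef) :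
    (Gᵀ * half A' * G * half B).trace
      ≤ 2 * t * (((invHalf A').trace - (invHalf A).trace) * (invHalf B).trace) := by
  have hP := (posDef_half hA').posSemidef
  have hQ := posDef_half hB
  have hT := (posDef_invHalf hB).posSemidef
  have hTr := hT.trace_nonneg
  have hQT : half B * invHalf B = 1 := mul_inv_cancel_posDef hQ
  -- Conjugating `B^{-1/2} ≤ tr(B^{-1/2}) · 1` by `B^{1/2}` trades `B^{1/2}` for `B`, which is the
  -- factor that the increment of `A⁻¹` controls.
  have hroot : ((invHalf B).trace • B - half B).PosSemidef := by
    have := posSemidef_conj (posSemidef_trace_smul_one_sub hT) (half B)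
    rw [transpose_eq hQ.posSemidef, Matrix.mul_sub, Matrix.sub_mul, hQT, Matrix.one_mul,
      Matrix.mul_smul, Matrix.mul_one, Matrix.smul_mul, half_mul_half hB.posSemidef] at this
    exact this
  have h1 := trace_mul_nonneg (posSemidef_conj' hP G) hroot
  rw [Matrix.mul_sub, Matrix.trace_sub, Matrix.mul_smul, Matrix.trace_smul, smul_eq_mul] at h1
  have h2 := trace_mul_nonneg hP h
  rw [Matrix.mul_sub, Matrix.trace_sub, Matrix.mul_smul, Matrix.trace_smul, smul_eq_mul] at h2
  have e : (Gᵀ * half A' * G * B).trace = (half A' * (G * B * Gᵀ)).trace := by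
    rw [Matrix.mul_assoc, Matrix.mul_assoc, Matrix.trace_mul_comm, Matrix.mul_assoc]
  have h3 := trace_half_mul_sub_le hA hA'
  rw [e] at h1
  have h4 : (half A' * (G * B * Gᵀ)).trace
      ≤ t * (2 * ((invHalf A').trace - (invHalf A).trace)) := by
    rw [← div_le_iff₀' ht, div_eq_inv_mul]
    linarith
  have h5 := mul_le_mul_of_nonneg_left h4 hTr
  linarith

/-- Cauchy–Schwarz on the diagonal of `X = A^{-1/2}`, whose squared entries sum to at most `tr(X²)`.
-/
theorem trace_invHalf_sq_le (hA : A.PosDef) : (invHalf A).trace ^ 2 ≤ p * (A⁻¹).trace := by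
  rw [← invHalf_mul_invHalf hA]
  set X := invHalf A
  have hX : Xᵀ = X := transpose_eq (posDef_invHalf hA).posSemidef
  have h1 : X.trace ^ 2 ≤ (p : ℝ) * ∑ i, X i i ^ 2 := by
    have := sq_sum_le_card_mul_sum_sq (s := Finset.univ) (f := fun i => X i i)
    simpa [Matrix.trace] using this
  refine h1.trans (mul_le_mul_of_nonneg_left ?_ p.cast_nonneg)
  refine Finset.sum_le_sum fun i _ => ?_
  have : (X * X).diag i = ∑ j, X i j ^ 2 := by
    conv_lhs => rw [← hX]; enter [1, 2]; rw [hX]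
    rw [Matrix.diag_apply, Matrix.mul_apply]
    refine Finset.sum_congr rfl fun j _ => ?_
    rw [hX, sq]
    congr 1
    exact (congrFun (congrFun hX i) j)
  rw [this]
  exact Finset.single_le_sum (f := fun j => X i j ^ 2) (fun j _ => sq_nonneg _) (Finset.mem_univ i)

end InverseRoot

end KrADagrad
namespace KrADagrad

/-! ### One iteration in the weighted norm. -/

section OneStep

variable {p q : ℕ}

theorem trace_conj_le {B : Matrix (Fin q) (Fin q) ℝ} (hB : B.PosSemidef)
    (G : Matrix (Fin p) (Fin q) ℝ) : (G * B * Gᵀ).trace ≤ B.trace * (Gᵀ * G).trace := by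
  have e : (G * B * Gᵀ).trace = (B * (Gᵀ * G)).trace := by
    rw [Matrix.mul_assoc, Matrix.trace_mul_comm, Matrix.mul_assoc]
  rw [e]
  exact trace_mul_le hB (by simpa using posSemidef_mul_transpose Gᵀ)

/-- All bounds on an updated statistic that enter the regret analysis. -/
theorem update_bounds {A : Matrix (Fin p) (Fin p) ℝ} {B : Matrix (Fin q) (Fin q) ℝ}
    {G : Matrix (Fin p) (Fin q) ℝ} {t c : ℝ} (hA : A.PosDef) (hB : B.PosDef)
    (hG : (Gᵀ * G).trace ≤ 1) (h1 : 1 ≤ t) (hc : t ≤ c)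
    (hcore : ((t - 1) • (1 : Matrix (Fin q) (Fin q) ℝ) - core A B G).PosSemidef) :
    (update A B G t).PosDef ∧ (update A B G t).trace ≤ A.trace ∧
      (invHalf (update A B G t) - invHalf A).PosSemidef ∧
      ((update A B G t)⁻¹).trace ≤ (A⁻¹).trace + B.trace ∧
      (Gᵀ * half (update A B G t) * G * half B).trace
        ≤ 2 * c * (((invHalf (update A B G t)).trace - (invHalf A).trace) * (invHalf B).trace) := by
  obtain ⟨hU, hlow, hup⟩ := posDef_update hA hB.posSemidef h1 hcore
  have t0 : 0 < t := by linarith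
  have hGB := posSemidef_conj hB.posSemidef G
  have hmono : (invHalf (update A B G t) - invHalf A).PosSemidef := by
    refine posSemidef_invHalf_sub hA hU ?_
    have := hlow.add (hGB.smul (inv_nonneg.2 t0.le))
    simpa using this
  refine ⟨hU, trace_update_le hA.posSemidef hB.posSemidef h1, hmono, ?_, ?_⟩
  · have h := hup.trace_nonneg
    rw [Matrix.trace_sub, Matrix.trace_add] at h
    have h2 := trace_conj_le hB.posSemidef G
    have h3 := mul_le_mul_of_nonneg_left hG hB.posSemidef.trace_nonneg
    linarith
  · refine (trace_step_le hA hU hB t0 hlow).trans ?_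
    have h := hmono.trace_nonneg
    rw [Matrix.trace_sub] at h
    exact mul_le_mul_of_nonneg_right (by linarith)
      (mul_nonneg h (posDef_invHalf hB).posSemidef.trace_nonneg)

theorem IsNormalizer.le_of_trace_le {A : Matrix (Fin p) (Fin p) ℝ} {B : Matrix (Fin q) (Fin q) ℝ}
    {G : Matrix (Fin p) (Fin q) ℝ} {t a b : ℝ} (ht : IsNormalizer A B G t) (hA : A.PosSemidef)
    (hB : B.PosSemidef) (hG : (Gᵀ * G).trace ≤ 1) (ha : A.trace ≤ a) (hb : B.trace ≤ b) :
    t ≤ 1 + a * b := by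
  refine (ht.le hA hB).trans (by
    have h2 := trace_conj_le hB G
    have h3 := mul_le_mul_of_nonneg_left hG hB.trace_nonneg
    have h4 : (G * B * Gᵀ).trace ≤ b := by linarith
    have := mul_le_mul ha h4 (posSemidef_conj hB G).trace_nonneg (hA.trace_nonneg.trans ha)
    linarith)

/-- The squared norm of `X` weighted by `T ⊗ S`. -/
noncomputable def weighted (S : Matrix (Fin p) (Fin p) ℝ) (T : Matrix (Fin q) (Fin q) ℝ)
    (X : Matrix (Fin p) (Fin q) ℝ) : ℝ := (Xᵀ * S * X * T).trace

variable {S S' : Matrix (Fin p) (Fin p) ℝ} {T T' : Matrix (Fin q) (Fin q) ℝ}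

theorem weighted_nonneg (hS : S.PosSemidef) (hT : T.PosSemidef) (X : Matrix (Fin p) (Fin q) ℝ) :
    0 ≤ weighted S T X :=
  trace_mul_nonneg (posSemidef_conj' hS X) hT

theorem weighted_le (hS : S.PosSemidef) (hT : T.PosSemidef) {X : Matrix (Fin p) (Fin q) ℝ} {d : ℝ}
    (hX : (Xᵀ * X).trace ≤ d) : weighted S T X ≤ d * (S.trace * T.trace) := by
  have h1 : (Xᵀ * S * X).trace ≤ S.trace * (Xᵀ * X).trace := by
    have := trace_conj_le hS Xᵀ
    rwa [Matrix.transpose_transpose, Matrix.trace_mul_comm X] at this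
  calc weighted S T X ≤ (Xᵀ * S * X).trace * T.trace := trace_mul_le (posSemidef_conj' hS X) hT
    _ ≤ (S.trace * d) * T.trace :=
        mul_le_mul_of_nonneg_right (h1.trans (mul_le_mul_of_nonneg_left hX hS.trace_nonneg))
          hT.trace_nonneg
    _ = d * (S.trace * T.trace) := by ring

theorem weighted_sub_left (X : Matrix (Fin p) (Fin q) ℝ) :
    weighted (S' - S) T X = weighted S' T X - weighted S T X := by
  simp [weighted, Matrix.mul_sub, Matrix.sub_mul]

theorem weighted_sub_right (X : Matrix (Fin p) (Fin q) ℝ) :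
    weighted S (T' - T) X = weighted S T' X - weighted S T X := by
  simp [weighted, Matrix.mul_sub]

/-- Preconditioned gradient step, expanded in the dual norm of the preconditioner. -/
theorem weighted_step {L : Matrix (Fin p) (Fin p) ℝ} {R : Matrix (Fin q) (Fin q) ℝ}
    (hL : L.PosDef) (hR : R.PosDef) (X G : Matrix (Fin p) (Fin q) ℝ) (η : ℝ) :
    weighted (invHalf L) (invHalf R) (X - η • (half L * G * half R))
      = weighted (invHalf L) (invHalf R) X - 2 * η * (Xᵀ * G).trace
        + η ^ 2 * (Gᵀ * half L * G * half R).trace := by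
  have hSP : invHalf L * half L = 1 := inv_mul_cancel_posDef (posDef_half hL)
  have hPS : half L * invHalf L = 1 := mul_inv_cancel_posDef (posDef_half hL)
  have hQT : half R * invHalf R = 1 := mul_inv_cancel_posDef (posDef_half hR)
  have hTQ : invHalf R * half R = 1 := inv_mul_cancel_posDef (posDef_half hR)
  have hPt := transpose_eq (posSemidef_half (A := L))
  have hQt := transpose_eq (posSemidef_half (A := R))
  set P := half L
  set Q := half R
  set S := invHalf L
  set T := invHalf R
  have e1 : Xᵀ * S * (P * G * Q) * T = Xᵀ * G := by
    rw [← Matrix.mul_assoc, Matrix.mul_assoc _ Q T, hQT, Matrix.mul_one, ← Matrix.mul_assoc,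
      Matrix.mul_assoc Xᵀ S P, hSP, Matrix.mul_one]
  have e2 : (P * G * Q)ᵀ * S = Q * Gᵀ := by
    rw [Matrix.transpose_mul, Matrix.transpose_mul, hPt, hQt, Matrix.mul_assoc, Matrix.mul_assoc,
      hPS, Matrix.mul_one]
  have e3 : ((P * G * Q)ᵀ * S * X * T).trace = (Xᵀ * G).trace := by
    rw [e2, Matrix.trace_mul_comm, ← Matrix.mul_assoc, ← Matrix.mul_assoc, hTQ, Matrix.one_mul,
      ← Matrix.trace_transpose, Matrix.transpose_mul, Matrix.transpose_transpose]
  have e4 : ((P * G * Q)ᵀ * S * (P * G * Q) * T).trace = (Gᵀ * P * G * Q).trace := by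
    rw [e2, ← Matrix.mul_assoc, Matrix.mul_assoc _ Q T, hQT, Matrix.mul_one, Matrix.mul_assoc,
      Matrix.trace_mul_comm, ← Matrix.mul_assoc]
  simp only [weighted, Matrix.transpose_sub, Matrix.transpose_smul, Matrix.sub_mul, Matrix.mul_sub,
    Matrix.smul_mul, Matrix.mul_smul, Matrix.trace_sub, Matrix.trace_smul, smul_eq_mul, e1, e3, e4]
  ring

end OneStep

/-! ### Convexity and Lipschitz bounds for the gradient. -/

section Convex

variable {E : Type*} [NormedAddCommGroup E] [InnerProductSpace ℝ E] [CompleteSpace E]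

theorem sub_le_inner_gradient {f : E → ℝ} {g x : E} (hf : ConvexOn ℝ Set.univ f)
    (hg : HasGradientAt f g x) (y : E) : f x - f y ≤ inner ℝ (x - y) g := by
  let l : ℝ →ᵃ[ℝ] E := AffineMap.lineMap x y
  have hφ : ConvexOn ℝ Set.univ (f ∘ l) := by
    simpa using hf.comp_affineMap l
  have hd : HasDerivAt (f ∘ l) (inner ℝ g (y - x)) 0 := by
    have hl : HasDerivAt l (y - x) 0 := AffineMap.hasDerivAt_lineMap
    have h0 : l 0 = x := AffineMap.lineMap_apply_zero x y
    have hF := hg.hasFDerivAt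
    rw [← h0] at hF
    simpa using hF.comp_hasDerivAt (0 : ℝ) hl
  have h := hφ.le_slope_of_hasDerivAt (Set.mem_univ 0) (Set.mem_univ 1) one_pos hd
  have h1 : l 1 = y := AffineMap.lineMap_apply_one x y
  have h0 : l 0 = x := AffineMap.lineMap_apply_zero x y
  simp only [slope_def_field, Function.comp, h0, h1, sub_zero, div_one] at h
  have e : inner ℝ (x - y) g = - inner ℝ g (y - x) := by
    rw [real_inner_comm, ← inner_neg_right, neg_sub]
  linarith

theorem norm_gradient_le {f : E → ℝ} {g x : E} (hf : LipschitzWith 1 f)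
    (hg : HasGradientAt f g x) : ‖g‖ ≤ 1 := by
  simpa using hg.hasFDerivAt.le_of_lipschitz hf

end Convex

section Vec

variable {m n : ℕ}

theorem inner_eq_trace (a b : Param m n) : inner ℝ a b = ((ofVec a)ᵀ * ofVec b).trace := by
  simp [PiLp.inner_apply, Fintype.sum_prod_type, Matrix.trace, Matrix.mul_apply, ofVec, mul_comm]

theorem norm_sq_eq_trace (a : Param m n) : ‖a‖ ^ 2 = ((ofVec a)ᵀ * ofVec a).trace := by
  rw [← inner_eq_trace, real_inner_self_eq_norm_sq]

end Vec

end KrADagrad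
namespace KrADagrad

/-! ### Telescoping along a run. -/

section Run

variable {m n : ℕ}

theorem numRight_zero (I : Set ℕ) : numRight I 0 = 0 := by
  simp [numRight]

theorem numRight_succ_of_mem {I : Set ℕ} {k : ℕ} (h : k + 1 ∈ I) :
    numRight I (k + 1) = numRight I k := by
  have : Set.Icc 1 (k + 1) \ I = Set.Icc 1 k \ I := by
    ext j
    simp only [Set.mem_sdiff, Set.mem_Icc]
    constructor
    · rintro ⟨⟨h1, h2⟩, h3⟩
      refine ⟨⟨h1, Nat.lt_succ_iff.1 (lt_of_le_of_ne h2 ?_)⟩, h3⟩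
      rintro rfl
      exact h3 h
    · rintro ⟨⟨h1, h2⟩, h3⟩
      exact ⟨⟨h1, by omega⟩, h3⟩
  rw [numRight, this, numRight]

theorem numRight_succ_of_notMem {I : Set ℕ} {k : ℕ} (h : k + 1 ∉ I) :
    numRight I (k + 1) = numRight I k + 1 := by
  have : Set.Icc 1 (k + 1) \ I = insert (k + 1) (Set.Icc 1 k \ I) := by
    ext j
    simp only [Set.mem_sdiff, Set.mem_Icc, Set.mem_insert_iff]
    constructor
    · rintro ⟨⟨h1, h2⟩, h3⟩
      by_cases hj : j = k + 1
      · exact Or.inl hj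
      · exact Or.inr ⟨⟨h1, by omega⟩, h3⟩
    · rintro (rfl | ⟨⟨h1, h2⟩, h3⟩)
      · exact ⟨⟨by omega, le_rfl⟩, h⟩
      · exact ⟨⟨h1, by omega⟩, h3⟩
  rw [numRight, this, Set.ncard_insert_of_notMem (by simp) ((Set.finite_Icc 1 k).sdiff), numRight]

/-- Bounds on the statistics after `k` iterations. -/
structure StatBounds (L₀ : Matrix (Fin m) (Fin m) ℝ) (R₀ : Matrix (Fin n) (Fin n) ℝ) (k N : ℕ)
    (L : Matrix (Fin m) (Fin m) ℝ) (R : Matrix (Fin n) (Fin n) ℝ) : Prop where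
  posDef_left : L.PosDef
  posDef_right : R.PosDef
  trace_left : L.trace ≤ L₀.trace
  trace_right : R.trace ≤ R₀.trace
  trace_inv_left : (L⁻¹).trace ≤ (L₀⁻¹).trace + k * R₀.trace
  trace_inv_right : (R⁻¹).trace ≤ (R₀⁻¹).trace + N * L₀.trace

/-- The trace of the preconditioner `R^{-1/2} ⊗ L^{-1/2}`. -/
noncomputable def potential (L : Matrix (Fin m) (Fin m) ℝ) (R : Matrix (Fin n) (Fin n) ℝ) : ℝ :=
  (invHalf L).trace * (invHalf R).trace

/-- Effect of one iteration on the statistics, the energy of the step and the weighted norm. -/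
structure StepBounds (c : ℝ) (G : Matrix (Fin m) (Fin n) ℝ)
    (L L' : Matrix (Fin m) (Fin m) ℝ) (R R' : Matrix (Fin n) (Fin n) ℝ) : Prop where
  energy : (Gᵀ * half L' * G * half R').trace ≤ 2 * c * (potential L' R' - potential L R)
  weighted_le : ∀ (X : Matrix (Fin m) (Fin n) ℝ) (d : ℝ), (Xᵀ * X).trace ≤ d →
    weighted (invHalf L') (invHalf R') X
      ≤ weighted (invHalf L) (invHalf R) X + d * (potential L' R' - potential L R)

variable {K : ℕ} {I : Set ℕ} {η D : ℝ} {f : ℕ → Param m n → ℝ}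
  {L₀ : Matrix (Fin m) (Fin m) ℝ} {R₀ : Matrix (Fin n) (Fin n) ℝ}
  {w g : ℕ → Param m n} {L : ℕ → Matrix (Fin m) (Fin m) ℝ}
  {R : ℕ → Matrix (Fin n) (Fin n) ℝ} {t : ℕ → ℝ} {wstar : Param m n}

theorem IsOnlineRun.trace_gradient_le (h : IsOnlineRun K I η D f L₀ R₀ w g L R t wstar) {k : ℕ}
    (hk : k ∈ Set.Icc 1 K) : ((ofVec (g k))ᵀ * ofVec (g k)).trace ≤ 1 := by
  rw [← norm_sq_eq_trace]
  exact pow_le_one₀ (norm_nonneg _)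
    (norm_gradient_le (h.lipschitz k hk) (h.run.gradient k hk))

/-- Only one of the two statistics moves, so the increase of the potential is the increase of one
trace times the other, fixed trace. This is the form of the one-sided bounds; an update of `R` is
the same statement for the transposed gradient. -/
theorem IsOnlineRun.step_bounds (h : IsOnlineRun K I η D f L₀ R₀ w g L R t wstar) {k : ℕ}
    (hk : k + 1 ≤ K) (hs : StatBounds L₀ R₀ k (numRight I k) (L k) (R k)) :
    StatBounds L₀ R₀ (k + 1) (numRight I (k + 1)) (L (k + 1)) (R (k + 1)) ∧
      StepBounds (1 + L₀.trace * R₀.trace) (ofVec (g (k + 1))) (L k) (L (k + 1)) (R k)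
        (R (k + 1)) := by
  have hk' : k + 1 ∈ Set.Icc 1 K := ⟨by omega, hk⟩
  have hG := h.trace_gradient_le hk'
  obtain ⟨hL, hR, tL, tR, iL, iR⟩ := hs
  have hL₀ : 0 ≤ L₀.trace := hL.posSemidef.trace_nonneg.trans tL
  have hR₀ : 0 ≤ R₀.trace := hR.posSemidef.trace_nonneg.trans tR
  have hS := (posDef_invHalf hL).posSemidef
  have hT := (posDef_invHalf hR).posSemidef
  by_cases hI : k + 1 ∈ I
  · obtain ⟨ht, eL, eR⟩ := h.run.update_left (k + 1) hk' hI
    simp only [Nat.add_sub_cancel] at ht eL eR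
    have hc := ht.le_of_trace_le hL.posSemidef hR.posSemidef hG tL tR
    obtain ⟨b1, b2, b3, b4, b5⟩ := update_bounds hL hR hG ht.one_le hc
      (ht.posSemidef_sub_core hL.posSemidef hR.posSemidef)
    rw [← eL] at b1 b2 b3 b4 b5
    rw [numRight_succ_of_mem hI, eR]
    refine ⟨⟨b1, hR, b2.trans tL, tR, ?_, iR⟩, ⟨?_, fun X d hX => ?_⟩⟩
    · push_cast; linarith
    · simpa only [potential, sub_mul] using b5
    · have := weighted_le b3 hT hX
      rw [weighted_sub_left, Matrix.trace_sub, sub_mul] at this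
      simp only [potential]
      linarith
  · obtain ⟨ht, eL, eR⟩ := h.run.update_right (k + 1) hk' hI
    simp only [Nat.add_sub_cancel] at ht eL eR
    have hG' : ((ofVec (g (k + 1)))ᵀᵀ * (ofVec (g (k + 1)))ᵀ).trace ≤ 1 := by
      rwa [Matrix.transpose_transpose, Matrix.trace_mul_comm]
    have key : 1 ≤ t (k + 1) ∧ t (k + 1) ≤ 1 + L₀.trace * R₀.trace ∧
        ((t (k + 1) - 1) • (1 : Matrix (Fin m) (Fin m) ℝ)
          - core (R k) (L k) (ofVec (g (k + 1)))ᵀ).PosSemidef := by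
      rcases ht with ht | ht
      · exact ⟨ht.one_le, ht.le_of_trace_le hL.posSemidef hR.posSemidef hG tL tR,
          ht.posSemidef_sub_core_transpose hR.posSemidef hL.posSemidef⟩
      · refine ⟨ht.one_le, ?_, ht.posSemidef_sub_core hR.posSemidef hL.posSemidef⟩
        rw [mul_comm L₀.trace]
        exact ht.le_of_trace_le hR.posSemidef hL.posSemidef hG' tR tL
    obtain ⟨b1, b2, b3, b4, b5⟩ := update_bounds hR hL hG' key.1 key.2.1 key.2.2
    rw [← eR] at b1 b2 b3 b4 b5
    rw [numRight_succ_of_notMem hI, eL]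
    refine ⟨⟨hL, b1, tL, b2.trans tR, ?_, ?_⟩, ⟨?_, fun X d hX => ?_⟩⟩
    -- `L` is unchanged here; its bound counts every iteration and merely gains the slack `tr R₀ ≥
    -- 0`.
    · push_cast; linarith
    · push_cast; linarith
    · have e : ((ofVec (g (k + 1)))ᵀ * half (L k) * ofVec (g (k + 1)) * half (R (k + 1))).trace
          = ((ofVec (g (k + 1)))ᵀᵀ * half (R (k + 1)) * (ofVec (g (k + 1)))ᵀ * half (L k)).trace := by
        rw [Matrix.transpose_transpose, Matrix.mul_assoc, Matrix.trace_mul_comm]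
        simp only [Matrix.mul_assoc]
      rw [e]
      refine b5.trans (le_of_eq ?_)
      simp only [potential]
      ring
    · have := weighted_le hS b3 hX
      rw [weighted_sub_right, Matrix.trace_sub, mul_sub] at this
      simp only [potential]
      linarith

theorem IsOnlineRun.stat_bounds (h : IsOnlineRun K I η D f L₀ R₀ w g L R t wstar)
    (hL₀ : L₀.PosDef) (hR₀ : R₀.PosDef) {k : ℕ} (hk : k ≤ K) :
    StatBounds L₀ R₀ k (numRight I k) (L k) (R k) := by
  induction k with
  | zero =>
    rw [h.run.init_left, h.run.init_right, numRight_zero]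
    exact ⟨hL₀, hR₀, le_rfl, le_rfl, by simp, by simp⟩
  | succ k ih => exact (h.step_bounds hk (ih (by omega))).1

theorem IsOnlineRun.regret_add_weighted_le (h : IsOnlineRun K I η D f L₀ R₀ w g L R t wstar)
    (hL₀ : L₀.PosDef) (hR₀ : R₀.PosDef) {k : ℕ} (hk : k ≤ K) :
    2 * η * regret k f w wstar
        + weighted (invHalf (L k)) (invHalf (R k)) (ofVec (w (k + 1) - wstar))
      ≤ weighted (invHalf (L 0)) (invHalf (R 0)) (ofVec (w 1 - wstar))
        + (D ^ 2 + 2 * (1 + L₀.trace * R₀.trace) * η ^ 2)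
          * (potential (L k) (R k) - potential (L 0) (R 0)) := by
  induction k with
  | zero => simp [regret]
  | succ k ih =>
    have hk' : k + 1 ∈ Set.Icc 1 K := ⟨by omega, hk⟩
    have hη := h.step_pos
    have ih := ih (by omega)
    have hs := h.stat_bounds hL₀ hR₀ (k := k) (by omega)
    obtain ⟨hs', hstep⟩ := h.step_bounds hk hs
    have hreg : regret (k + 1) f w wstar
        = regret k f w wstar + (f (k + 1) (w (k + 1)) - f (k + 1) wstar) := by
      rw [regret, Finset.sum_Icc_succ_top (by omega), regret]
    have hconv := sub_le_inner_gradient (h.convex _ hk') (h.run.gradient _ hk') wstar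
    rw [inner_eq_trace] at hconv
    have hD : ((ofVec (w (k + 1) - wstar))ᵀ * ofVec (w (k + 1) - wstar)).trace ≤ D ^ 2 := by
      rw [← norm_sq_eq_trace]
      exact pow_le_pow_left₀ (norm_nonneg _) (h.dist_le _ hk') 2
    -- The metric changes first, at the current iterate, and the step is then expanded in the new
    -- metric. Hence only the iterates up to `K` need to be within `D`.
    have hw := hstep.weighted_le _ _ hD
    have hstp := weighted_step hs'.posDef_left hs'.posDef_right (ofVec (w (k + 1) - wstar))
      (ofVec (g (k + 1))) η
    have eX : ofVec (w (k + 1) - wstar)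
        - η • (half (L (k + 1)) * ofVec (g (k + 1)) * half (R (k + 1)))
        = ofVec (w (k + 1 + 1) - wstar) := by
      rw [h.run.step _ hk']
      ext i j
      simp [ofVec, toVec, Matrix.vec]
      ring
    rw [eX] at hstp
    have hen := mul_le_mul_of_nonneg_left hstep.energy (sq_nonneg η)
    have hc2 := mul_le_mul_of_nonneg_left hconv (by linarith : 0 ≤ 2 * η)
    rw [hreg, hstp]
    linarith

/-- The final weighted distance is dropped, and the initial one is at most `D²` times the initial
potential, which the telescoped sum subtracts. -/
theorem IsOnlineRun.regret_le_potential (h : IsOnlineRun K I η D f L₀ R₀ w g L R t wstar)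
    (hL₀ : L₀.PosDef) (hR₀ : R₀.PosDef) :
    regret K f w wstar
      ≤ (1 + L₀.trace * R₀.trace) * (D ^ 2 / η + η) * potential (L K) (R K) := by
  have hη := h.step_pos
  have hc : 0 ≤ L₀.trace * R₀.trace :=
    mul_nonneg hL₀.posSemidef.trace_nonneg hR₀.posSemidef.trace_nonneg
  have hs := h.stat_bounds hL₀ hR₀ le_rfl
  have hS := (posDef_invHalf hs.posDef_left).posSemidef
  have hT := (posDef_invHalf hs.posDef_right).posSemidef
  have hτ : 0 ≤ potential (L K) (R K) := mul_nonneg hS.trace_nonneg hT.trace_nonneg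
  rcases Nat.eq_zero_or_pos K with rfl | hK
  -- With no iterations, the distance from `w 1` to the comparator is not controlled by `D`.
  · rw [show regret 0 f w wstar = 0 by simp [regret]]
    positivity
  · have h1 := h.regret_add_weighted_le hL₀ hR₀ le_rfl
    have h2 := weighted_nonneg hS hT (ofVec (w (K + 1) - wstar))
    have hs0 := h.stat_bounds hL₀ hR₀ (Nat.zero_le K)
    have hS0 := (posDef_invHalf hs0.posDef_left).posSemidef
    have hT0 := (posDef_invHalf hs0.posDef_right).posSemidef
    have hτ0 : 0 ≤ potential (L 0) (R 0) := mul_nonneg hS0.trace_nonneg hT0.trace_nonneg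
    have h3 : weighted (invHalf (L 0)) (invHalf (R 0)) (ofVec (w 1 - wstar))
        ≤ D ^ 2 * potential (L 0) (R 0) := by
      refine weighted_le hS0 hT0 ?_
      rw [← norm_sq_eq_trace]
      exact pow_le_pow_left₀ (norm_nonneg _) (h.dist_le 1 ⟨le_rfl, hK⟩) 2
    have h4 : 2 * η * regret K f w wstar
        ≤ (D ^ 2 + 2 * (1 + L₀.trace * R₀.trace) * η ^ 2) * potential (L K) (R K) := by
      have : 0 ≤ 2 * (1 + L₀.trace * R₀.trace) * η ^ 2 * potential (L 0) (R 0) := by positivity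
      linarith
    have h5 : (D ^ 2 + 2 * (1 + L₀.trace * R₀.trace) * η ^ 2) * potential (L K) (R K)
        ≤ 2 * η * ((1 + L₀.trace * R₀.trace) * (D ^ 2 / η + η) * potential (L K) (R K)) := by
      have e : 2 * η * ((1 + L₀.trace * R₀.trace) * (D ^ 2 / η + η) * potential (L K) (R K))
          = (2 * (1 + L₀.trace * R₀.trace) * D ^ 2 + 2 * (1 + L₀.trace * R₀.trace) * η ^ 2)
            * potential (L K) (R K) := by
        field_simp
      rw [e]
      refine mul_le_mul_of_nonneg_right ?_ hτ
      linarith [mul_nonneg hc (sq_nonneg D), sq_nonneg D]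
    exact le_of_mul_le_mul_left (h4.trans h5) (by positivity)

theorem StatBounds.potential_le {L : Matrix (Fin m) (Fin m) ℝ} {R : Matrix (Fin n) (Fin n) ℝ}
    {k N : ℕ} (h : StatBounds L₀ R₀ k N L R) (hL₀ : L₀.PosDef) (hR₀ : R₀.PosDef) :
    potential L R
      ≤ √(m * ((L₀⁻¹).trace + R₀.trace) * (n * ((R₀⁻¹).trace + L₀.trace)))
        * √((1 + k) * (1 + N)) := by
  have hS := (posDef_invHalf h.posDef_left).posSemidef.trace_nonneg
  have hT := (posDef_invHalf h.posDef_right).posSemidef.trace_nonneg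
  have a0 := hL₀.inv.posSemidef.trace_nonneg
  have b0 := hR₀.inv.posSemidef.trace_nonneg
  have a1 := hL₀.posSemidef.trace_nonneg
  have b1 := hR₀.posSemidef.trace_nonneg
  have hk : (0 : ℝ) ≤ k := k.cast_nonneg
  have hN : (0 : ℝ) ≤ N := N.cast_nonneg
  have hl : (invHalf L).trace ^ 2 ≤ m * ((L₀⁻¹).trace + R₀.trace) * (1 + k) := by
    refine (trace_invHalf_sq_le h.posDef_left).trans ?_
    rw [mul_assoc]
    refine mul_le_mul_of_nonneg_left (h.trace_inv_left.trans ?_) m.cast_nonneg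
    linarith [mul_nonneg hk a0]
  have hr : (invHalf R).trace ^ 2 ≤ n * ((R₀⁻¹).trace + L₀.trace) * (1 + N) := by
    refine (trace_invHalf_sq_le h.posDef_right).trans ?_
    rw [mul_assoc]
    refine mul_le_mul_of_nonneg_left (h.trace_inv_right.trans ?_) n.cast_nonneg
    linarith [mul_nonneg hN b0]
  rw [← Real.sqrt_mul (by positivity)]
  refine Real.le_sqrt_of_sq_le ?_
  rw [potential, mul_pow]
  calc _ ≤ _ := mul_le_mul hl hr (sq_nonneg _) (by positivity)
    _ = _ := by ring

/-- Regret bound for an arbitrary number of updates of the right statistic. -/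
theorem exists_regret_le (hL₀ : L₀.PosDef) (hR₀ : R₀.PosDef) :
    ∃ C : ℝ, 0 < C ∧
      ∀ (K : ℕ) (I : Set ℕ) (η D : ℝ) (f : ℕ → Param m n → ℝ)
        (w g : ℕ → Param m n) (L : ℕ → Matrix (Fin m) (Fin m) ℝ)
        (R : ℕ → Matrix (Fin n) (Fin n) ℝ) (t : ℕ → ℝ) (wstar : Param m n),
        IsOnlineRun K I η D f L₀ R₀ w g L R t wstar →
        regret K f w wstar ≤ C * (D ^ 2 / η + η) * √((1 + K) * (1 + numRight I K)) := by
  have a1 := hL₀.posSemidef.trace_nonneg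
  have b1 := hR₀.posSemidef.trace_nonneg
  set M := √(m * ((L₀⁻¹).trace + R₀.trace) * (n * ((R₀⁻¹).trace + L₀.trace))) with hM
  have hM0 : 0 ≤ M := Real.sqrt_nonneg _
  -- `M` vanishes if `m = 0` or `n = 0`; the added 1 keeps the constant positive.
  refine ⟨(1 + L₀.trace * R₀.trace) * (M + 1), by positivity, ?_⟩
  intro K I η D f w g L R t wstar h
  have hη := h.step_pos
  have hp := (h.stat_bounds hL₀ hR₀ le_rfl).potential_le hL₀ hR₀
  rw [← hM] at hp
  have hp' : potential (L K) (R K) ≤ (M + 1) * √((1 + K) * (1 + numRight I K)) :=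
    hp.trans (mul_le_mul_of_nonneg_right (by linarith) (Real.sqrt_nonneg _))
  calc regret K f w wstar
      ≤ (1 + L₀.trace * R₀.trace) * (D ^ 2 / η + η) * potential (L K) (R K) :=
        h.regret_le_potential hL₀ hR₀
    _ ≤ (1 + L₀.trace * R₀.trace) * (D ^ 2 / η + η)
          * ((M + 1) * √((1 + K) * (1 + numRight I K))) :=
        mul_le_mul_of_nonneg_left hp' (by positivity)
    _ = _ := by ring

end Run

/-! ### From the general bound to the two stated rates. -/

theorem exists_one_add_le_rpow {ε : ℝ} {K' : ℕ → ℕ} (hε : 0 ≤ ε)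
    (h : (fun K : ℕ => (K' K : ℝ)) =O[atTop] (fun K : ℕ => (K : ℝ) ^ (2 * ε))) :
    ∃ c : ℝ, 0 < c ∧ ∀ K : ℕ, 1 ≤ K → 1 + (K' K : ℝ) ≤ c * (K : ℝ) ^ (2 * ε) := by
  -- On the naturals an asymptotic bound holds with one constant wherever the comparison function is
  -- nonzero, here for all `K ≥ 1`. The extra 1 is absorbed since `K^{2ε} ≥ 1`.
  obtain ⟨c, hc, hb⟩ := bound_of_isBigO_nat_atTop h
  refine ⟨1 + c, by positivity, fun K hK => ?_⟩
  have hK1 : (1 : ℝ) ≤ K := by exact_mod_cast hK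
  have h1 : 1 ≤ (K : ℝ) ^ (2 * ε) := Real.one_le_rpow hK1 (by positivity)
  have h2 := hb (x := K) (by positivity)
  rw [Real.norm_of_nonneg (by positivity), Real.norm_of_nonneg (by positivity)] at h2
  linarith

end KrADagrad

theorem mainTheorem2 (m n : ℕ)
    (L₀ : Matrix (Fin m) (Fin m) ℝ) (R₀ : Matrix (Fin n) (Fin n) ℝ)
    (hL₀ : L₀.PosDef) (hR₀ : R₀.PosDef) :
    (∃ C : ℝ, 0 < C ∧
      ∀ (K : ℕ) (I : Set ℕ) (η D : ℝ) (f : ℕ → KrADagrad.Param m n → ℝ)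
        (w g : ℕ → KrADagrad.Param m n) (L : ℕ → Matrix (Fin m) (Fin m) ℝ)
        (R : ℕ → Matrix (Fin n) (Fin n) ℝ) (t : ℕ → ℝ) (wstar : KrADagrad.Param m n),
        KrADagrad.IsOnlineRun K I η D f L₀ R₀ w g L R t wstar →
        1 ≤ KrADagrad.numRight I K →
        KrADagrad.regret K f w wstar ≤
          C * (D ^ 2 / η + η) * Real.sqrt ((K : ℝ) * (KrADagrad.numRight I K : ℝ))) ∧
    (∀ (ε : ℝ) (K' : ℕ → ℕ), 0 ≤ ε →
      (fun K : ℕ => (K' K : ℝ)) =Θ[atTop] (fun K : ℕ => (K : ℝ) ^ (2 * ε)) →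
      ∃ C : ℝ, 0 < C ∧
        ∀ (K : ℕ) (I : Set ℕ) (η D : ℝ) (f : ℕ → KrADagrad.Param m n → ℝ)
          (w g : ℕ → KrADagrad.Param m n) (L : ℕ → Matrix (Fin m) (Fin m) ℝ)
          (R : ℕ → Matrix (Fin n) (Fin n) ℝ) (t : ℕ → ℝ) (wstar : KrADagrad.Param m n),
          1 ≤ K →
          KrADagrad.IsOnlineRun K I η D f L₀ R₀ w g L R t wstar →
          KrADagrad.numRight I K = K' K →
          KrADagrad.regret K f w wstar ≤
            C * (D ^ 2 / η + η) * (K : ℝ) ^ (1 / 2 + ε)) := by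
  obtain ⟨C, hC, hreg⟩ := KrADagrad.exists_regret_le hL₀ hR₀
  constructor
  -- For `K, K' ≥ 1`, `(1 + K)(1 + K') ≤ 4 K K'`, whose root gives the factor 2.
  · refine ⟨2 * C, by positivity, ?_⟩
    intro K I η D f w g L R t wstar h hN
    have hη := h.step_pos
    refine (hreg K I η D f w g L R t wstar h).trans ?_
    have hN1 : (1 : ℝ) ≤ KrADagrad.numRight I K := by exact_mod_cast hN
    have hK1 : (1 : ℝ) ≤ K := by
      rcases Nat.eq_zero_or_pos K with rfl | hK
      · rw [KrADagrad.numRight_zero] at hN; omega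
      · exact_mod_cast hK
    have hs : √((1 + K : ℝ) * (1 + KrADagrad.numRight I K))
        ≤ 2 * √((K : ℝ) * KrADagrad.numRight I K) := by
      refine Real.sqrt_le_iff.2 ⟨by positivity, ?_⟩
      rw [mul_pow, Real.sq_sqrt (by positivity)]
      nlinarith
    calc C * (D ^ 2 / η + η) * √((1 + K : ℝ) * (1 + KrADagrad.numRight I K))
        ≤ C * (D ^ 2 / η + η) * (2 * √((K : ℝ) * KrADagrad.numRight I K)) :=
          mul_le_mul_of_nonneg_left hs (by positivity)
      _ = _ := by ring
  · intro ε K' hε hΘ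
    obtain ⟨c, hc, hb⟩ := KrADagrad.exists_one_add_le_rpow hε hΘ.isBigO
    -- The factor 2 comes from `1 + K ≤ 2K`, and `c` from `1 + K' ≤ c K^{2ε}`.
    refine ⟨C * √(2 * c), by positivity, ?_⟩
    intro K I η D f w g L R t wstar hK h hN
    have hη := h.step_pos
    refine (hreg K I η D f w g L R t wstar h).trans ?_
    rw [hN]
    have hK1 : (1 : ℝ) ≤ K := by exact_mod_cast hK
    have hK0 : (0 : ℝ) < K := by linarith
    have hs : √((1 + K : ℝ) * (1 + K' K)) ≤ √(2 * c) * (K : ℝ) ^ (1 / 2 + ε) := by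
      refine Real.sqrt_le_iff.2 ⟨by positivity, ?_⟩
      have e : ((K : ℝ) ^ (1 / 2 + ε)) ^ 2 = K * (K : ℝ) ^ (2 * ε) := by
        rw [← Real.rpow_natCast, ← Real.rpow_mul hK0.le]
        nth_rewrite 2 [← Real.rpow_one (K : ℝ)]
        rw [← Real.rpow_add hK0]
        congr 1
        push_cast
        ring
      rw [mul_pow, Real.sq_sqrt (by positivity), e]
      calc (1 + K : ℝ) * (1 + K' K) ≤ (2 * K) * (c * (K : ℝ) ^ (2 * ε)) :=
            mul_le_mul (by linarith) (hb K hK) (by positivity) (by positivity)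
        _ = _ := by ring
    calc C * (D ^ 2 / η + η) * √((1 + K : ℝ) * (1 + K' K))
        ≤ C * (D ^ 2 / η + η) * (√(2 * c) * (K : ℝ) ^ (1 / 2 + ε)) :=
          mul_le_mul_of_nonneg_left hs (by positivity)
      _ = _ := by ring
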